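/- Throughout, a function $f$ is regularly varying with index $\rho\in\mathbb R$, written $f\in\mathcal{RV}_\rho$, if it is measurable and strictly positive on some half-line $[X,\infty)$ and $f(\lambda x)/f(x)\to\lambda^\rho$ as $x\to\infty$ for every $\lambda>0$; it is slowly varying if $f\in\mathcal{RV}_0$. The de Haan class $\Pi$ consists of all functions $f$ for which there are a slowly varying function $\ell$ and a constant $c\neq 0$ such that $$\lim_{x\to\infty}\frac{f(\lambda x)-f(x)}{\ell(x)}=c\log\lambda\qquad\text{for every }\lambda>0.$$ **Theorem.** Let $F$ be the distribution function of a nonnegative random variable, $\overline F=1-F$, let $\beta>0$, and assume $\int_{[0,\infty)}y^\beta\,dF(y)=\infty$. Put $$h_\beta(x)=\beta\int_0^x y^{\beta-1}\,\overline F(y)\,dy,\qquad V_\beta(x)=\int_{[0,x]}y^\beta\,dF(y).$$ For $\rho\in[0,\beta]$ consider the conditions 1. $h_\beta\in\mathcal{RV}_\rho$; 2. $V_\beta\in\mathcal{RV}_\rho$; 3. $\overline F\in\mathcal{RV}_{\rho-\beta}$; 4. $\displaystyle\lim_{x\to\infty}\frac{x^\beta\,\overline F(x)}{h_\beta(x)}=\frac{\rho}{\beta}$;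 5. $\displaystyle\lim_{x\to\infty}\frac{V_\beta(x)}{h_\beta(x)}=1-\frac{\rho}{\beta}$. - For every $\rho\in(0,\beta)$, conditions 1–5 are equivalent. - If $\rho=0$, conditions 1, 2, 4 and 5 are equivalent, and condition 3 implies each of them. - If $\rho=\beta$, conditions 1, 3, 4 and 5 are equivalent, and condition 2 implies each of them. Moreover, condition 2 (that is, $V_\beta\in\mathcal{RV}_\beta$) holds if and only if $\overline F\in\Pi$. -/

import Mathlib

open MeasureTheory ProbabilityTheory Filter Set Topology

noncomputable section

namespace TruncatedMoments

/-- `f` is regularly varying (at infinity) with index `ρ`: on some half-line `[X, ∞)` it is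
measurable and strictly positive, and `f (l x) / f x → l ^ ρ` as `x → ∞` for every `l > 0`. -/
def RegularlyVarying (f : ℝ → ℝ) (ρ : ℝ) : Prop :=
  (∃ X : ℝ, Measurable (fun x : Ici X => f x) ∧ ∀ x ∈ Ici X, 0 < f x) ∧
    ∀ l : ℝ, 0 < l → Tendsto (fun x => f (l * x) / f x) atTop (𝓝 (l ^ ρ))

/-- Slow variation is regular variation with index `0`. -/
def SlowlyVarying (f : ℝ → ℝ) : Prop := RegularlyVarying f 0

/-- `f` belongs to the de Haan class `Π_ℓ` with index `c`. -/
def DeHaanWithIndex (f ℓ : ℝ → ℝ) (c : ℝ) : Prop :=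
  ∀ l : ℝ, 0 < l →
    Tendsto (fun x => (f (l * x) - f x) / ℓ x) atTop (𝓝 (c * Real.log l))

/-- The de Haan class `Π`: `f ∈ Π_ℓ` with a nonzero index for some slowly varying `ℓ`. -/
def DeHaanClass (f : ℝ → ℝ) : Prop :=
  ∃ ℓ : ℝ → ℝ, SlowlyVarying ℓ ∧ ∃ c : ℝ, c ≠ 0 ∧ DeHaanWithIndex f ℓ c

/-- The tail `1 - F`, where `F` is the distribution function of `μ`. -/
def tail (μ : Measure ℝ) (x : ℝ) : ℝ := 1 - cdf μ x

/-- `h_β(x) = β ∫₀ˣ y^(β-1) (1 - F(y)) dy`. -/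
def hTrunc (μ : Measure ℝ) (β x : ℝ) : ℝ := β * ∫ y in (0 : ℝ)..x, y ^ (β - 1) * tail μ y

/-- `V_β(x) = ∫_{[0,x]} y^β dF(y)`. -/
def VTrunc (μ : Measure ℝ) (β x : ℝ) : ℝ := ∫ y in Icc (0 : ℝ) x, y ^ β ∂μ

end TruncatedMoments

end

namespace TruncatedMoments

/-! Write T for the tail, h for `hTrunc`, V for `VTrunc`. Everything rests on the integration by
parts h = V + x^β T, which makes conditions 4 and 5 equivalent, and on two derivatives: h' = β
x^(β-1) T and (x^(-β) h)' = -β x^(-β-1) V.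

By the first derivative, x h'/h is β times the ratio in condition 4, so integrating the logarithmic
derivative gives 4 → 1. The converse is a monotone density argument: T is nonincreasing, so the
increments of h bound x^β T on both sides. Once 1 and 4 hold, T ~ (ρ/β) x^(-β) h gives 3 when ρ > 0,
and V ~ (1 - ρ/β) h gives 2 when ρ < β; at the endpoints one of these constants vanishes. For 3 → 1,
compare the integrands of h(lx) and h(x). For 2 → 1, use the second derivative: x^(-β) h tends to 0,
so it is the integral over [x, ∞) of β y^(-β-1) V(y), and integrands can be compared again.

For the de Haan statement, T = x^(-β) h - x^(-β) V. If V has index β, then ℓ = x^(-β) V is slowly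
varying; the increments of the first term are asymptotic to -β ℓ log l and those of the second are
o(ℓ). Conversely, V(x) - V(x/2) is x^β times a weighted mean of increments of T, hence asymptotic to
C x^β ℓ(x) with C > 0; telescoping over dyadic scales passes this regular variation on to V.
Monotonicity of T and V supplies the dominating functions, so no uniform convergence theorem is
needed. -/

/-! ### Comparison tools for regular variation and for ratios of integrals -/

/-- A function comparable to `x ^ a * g x`, with `g` regularly varying of index `ρ`, is regularly
varying of index `ρ + a`. -/
lemma RegularlyVarying.of_tendsto_div {f g : ℝ → ℝ} {ρ a C : ℝ} (hg : RegularlyVarying g ρ)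
    {X₀ : ℝ} (hf : Measurable fun x : Ici X₀ => f x) (hC : 0 < C)
    (h : Tendsto (fun x => f x / (x ^ a * g x)) atTop (𝓝 C)) :
    RegularlyVarying f (ρ + a) := by
  obtain ⟨⟨X, -, hXpos⟩, hlim⟩ := hg
  have hpos : ∀ᶠ x in atTop, 0 < f x := by
    filter_upwards [h.eventually (lt_mem_nhds hC), eventually_ge_atTop X, eventually_gt_atTop 0]
      with x hx hxX hx0
    have : 0 < x ^ a * g x := mul_pos (Real.rpow_pos_of_pos hx0 _) (hXpos x hxX)
    exact (div_pos_iff_of_pos_right this).1 hx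
  obtain ⟨Y, hY⟩ := eventually_atTop.1 hpos
  refine ⟨⟨max X₀ Y, ?_, fun x hx => hY x ((le_max_right _ _).trans hx)⟩, fun l hl => ?_⟩
  · exact hf.comp (measurable_inclusion (Ici_subset_Ici.2 (le_max_left _ _)))
  have hmul : Tendsto (fun x : ℝ => l * x) atTop atTop := tendsto_id.const_mul_atTop hl
  have key := (((h.comp hmul).div h hC.ne').mul (hlim l hl)).mul_const (l ^ a)
  rw [div_self hC.ne', one_mul, ← Real.rpow_add hl] at key
  refine key.congr' ?_
  filter_upwards [hpos, hmul.eventually hpos, eventually_ge_atTop X, hmul.eventually_ge_atTop X,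
    eventually_gt_atTop 0] with x h1 h2 h3 h4 h5
  have g1 := hXpos x h3
  have g2 := hXpos _ h4
  have p1 : 0 < x ^ a := Real.rpow_pos_of_pos h5 _
  have p2 : 0 < l ^ a := Real.rpow_pos_of_pos hl _
  simp only [Function.comp_apply, Pi.div_apply]
  rw [Real.mul_rpow hl.le h5.le]
  field_simp

/-- Continuous analogue of the Stolz–Cesàro theorem. -/
lemma tendsto_integral_div_integral {f g : ℝ → ℝ} {c : ℝ}
    (hf : ∀ x, 0 ≤ x → IntervalIntegrable f volume 0 x)
    (hg : ∀ x, 0 ≤ x → IntervalIntegrable g volume 0 x) (hgpos : ∀ᶠ x in atTop, 0 < g x)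
    (hginf : Tendsto (fun x => ∫ y in (0 : ℝ)..x, g y) atTop atTop)
    (hfg : Tendsto (fun x => f x / g x) atTop (𝓝 c)) :
    Tendsto (fun x => (∫ y in (0 : ℝ)..x, f y) / ∫ y in (0 : ℝ)..x, g y) atTop (𝓝 c) := by
  rw [Metric.tendsto_atTop']
  intro ε hε
  obtain ⟨X, hX⟩ := eventually_atTop.1
    ((hgpos.and (hfg.eventually (Metric.ball_mem_nhds c (half_pos hε)))).and
      (eventually_ge_atTop 0))
  obtain ⟨⟨-, -⟩, hX0⟩ := hX X le_rfl
  -- Beyond X the error is at most ε/2 times the integral of g, so the total error on [0, x] is at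
  -- most K plus ε/2 times the integral of g over [0, x]. Divergence of the latter absorbs K into
  -- the second half of ε.
  set K := |∫ y in (0 : ℝ)..X, (f y - c * g y)| - ε / 2 * ∫ y in (0 : ℝ)..X, g y with hK
  obtain ⟨Y, hY⟩ := eventually_atTop.1 ((hginf.eventually_gt_atTop (K / (ε / 2))).and
    (hginf.eventually_gt_atTop 0))
  refine ⟨max X Y, fun x hx => ?_⟩
  have hxX : X ≤ x := (le_max_left _ _).trans hx.le
  obtain ⟨h1, h2⟩ := hY x ((le_max_right _ _).trans hx.le)
  have hx0 : 0 ≤ x := hX0.trans hxX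
  have If : IntervalIntegrable f volume X x := (hf X hX0).symm.trans (hf x hx0)
  have Ig : IntervalIntegrable g volume X x := (hg X hX0).symm.trans (hg x hx0)
  have hsub : (∫ y in (0 : ℝ)..x, f y) - c * ∫ y in (0 : ℝ)..x, g y
      = (∫ y in (0 : ℝ)..X, (f y - c * g y)) + ∫ y in X..x, (f y - c * g y) := by
    rw [intervalIntegral.integral_add_adjacent_intervals
      ((hf X hX0).sub ((hg X hX0).const_mul c)) (If.sub (Ig.const_mul c)),
      intervalIntegral.integral_sub (hf x hx0) ((hg x hx0).const_mul c),
      intervalIntegral.integral_const_mul]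
  have hb : |∫ y in X..x, (f y - c * g y)| ≤ ε / 2 * ∫ y in X..x, g y := by
    rw [← intervalIntegral.integral_const_mul, ← Real.norm_eq_abs]
    refine intervalIntegral.norm_integral_le_of_norm_le hxX (Eventually.of_forall fun y hy => ?_)
      (Ig.const_mul _)
    obtain ⟨⟨k1, k2⟩, -⟩ := hX y hy.1.le
    rw [Real.dist_eq] at k2
    have : f y - c * g y = (f y / g y - c) * g y := by field_simp
    rw [this, Real.norm_eq_abs, abs_mul, abs_of_pos k1]
    gcongr
  have hadd := intervalIntegral.integral_add_adjacent_intervals (hg X hX0) Ig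
  rw [Real.dist_eq, div_sub' h2.ne', abs_div, abs_of_pos h2, div_lt_iff₀ h2,
    mul_comm _ c, hsub]
  rw [div_lt_iff₀ (half_pos hε)] at h1
  have := abs_add_le (∫ y in (0 : ℝ)..X, (f y - c * g y)) (∫ y in X..x, (f y - c * g y))
  nlinarith

/-! ### The tail, the truncated moments and integration by parts -/

section Basic

variable (μ : Measure ℝ)

lemma tail_nonneg (x : ℝ) : 0 ≤ tail μ x := sub_nonneg.2 (cdf_le_one μ x)

lemma tail_le_one (x : ℝ) : tail μ x ≤ 1 := sub_le_self _ (cdf_nonneg μ x)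

lemma tail_antitone : Antitone (tail μ) := fun _ _ h => sub_le_sub_left (monotone_cdf μ h) _

lemma measurable_tail : Measurable (tail μ) := (tail_antitone μ).measurable

lemma tendsto_tail_atTop : Tendsto (tail μ) atTop (𝓝 0) := by
  simpa using! (tendsto_cdf_atTop μ).const_sub 1

lemma continuousWithinAt_tail (x : ℝ) : ContinuousWithinAt (tail μ) (Ioi x) x :=
  continuousWithinAt_const.sub (((cdf μ).right_continuous x).mono Ioi_subset_Ici_self)

lemma measure_Ioi_eq_tail [IsProbabilityMeasure μ] (x : ℝ) :
    μ (Ioi x) = ENNReal.ofReal (tail μ x) := by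
  rw [← compl_Iic, prob_compl_eq_one_sub measurableSet_Iic, ← ofReal_cdf, tail,
    ENNReal.ofReal_sub _ (cdf_nonneg μ x), ENNReal.ofReal_one]

lemma intervalIntegrable_rpow_mul_tail {β : ℝ} (hβ : 0 < β) (a b : ℝ) :
    IntervalIntegrable (fun y => y ^ (β - 1) * tail μ y) volume a b := by
  refine (intervalIntegral.intervalIntegrable_rpow' (r := β - 1) (by linarith)).mono_fun
    ((by fun_prop : Measurable fun y : ℝ => y ^ (β - 1)).mul
      (measurable_tail μ)).aestronglyMeasurable ?_
  refine Eventually.of_forall fun y => ?_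
  dsimp only
  rw [norm_mul, Real.norm_of_nonneg (tail_nonneg μ y)]
  exact mul_le_of_le_one_right (norm_nonneg _) (tail_le_one μ y)

lemma integral_rpow_sub_one {β : ℝ} (hβ : 0 < β) (a b : ℝ) :
    β * ∫ y in a..b, y ^ (β - 1) = b ^ β - a ^ β := by
  rw [integral_rpow (Or.inl (by linarith)), sub_add_cancel]
  field_simp

lemma integrableOn_rpow [IsFiniteMeasure μ] {β : ℝ} (hβ : 0 < β) (x : ℝ) :
    IntegrableOn (fun y => y ^ β) (Icc 0 x) μ :=
  ContinuousOn.integrableOn_compact isCompact_Icc (Real.continuous_rpow_const hβ.le).continuousOn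

lemma VTrunc_nonneg (β x : ℝ) : 0 ≤ VTrunc μ β x :=
  setIntegral_nonneg measurableSet_Icc fun _ hy => Real.rpow_nonneg hy.1 _

lemma VTrunc_mono [IsFiniteMeasure μ] {β : ℝ} (hβ : 0 < β) : Monotone (VTrunc μ β) := by
  intro x y hxy
  refine setIntegral_mono_set (integrableOn_rpow μ hβ y) ?_ (Icc_subset_Icc_right hxy).eventuallyLE
  filter_upwards [self_mem_ae_restrict measurableSet_Icc] with z hz using Real.rpow_nonneg hz.1 _

lemma ofReal_VTrunc [IsFiniteMeasure μ] {β : ℝ} (hβ : 0 < β) (x : ℝ) :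
    ENNReal.ofReal (VTrunc μ β x) = ∫⁻ y in Icc 0 x, ENNReal.ofReal (y ^ β) ∂μ := by
  refine ofReal_integral_eq_lintegral_ofReal (integrableOn_rpow μ hβ x) ?_
  filter_upwards [self_mem_ae_restrict measurableSet_Icc] with z hz using Real.rpow_nonneg hz.1 _

lemma tendsto_VTrunc_atTop [IsFiniteMeasure μ] {β : ℝ} (hβ : 0 < β)
    (hinf : ∫⁻ y in Ici (0 : ℝ), ENNReal.ofReal (y ^ β) ∂μ = ⊤) :
    Tendsto (VTrunc μ β) atTop atTop := by
  have hcov : AECover (μ.restrict (Ici 0)) atTop (fun x : ℝ => Iic x) := aecover_Iic tendsto_id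
  have key := hcov.lintegral_tendsto_of_countably_generated
    (f := fun y => ENNReal.ofReal (y ^ β)) (by fun_prop)
  rw [hinf] at key
  have h2 : Tendsto (fun x => ENNReal.ofReal (VTrunc μ β x)) atTop (𝓝 ⊤) := by
    refine key.congr fun x => ?_
    rw [ofReal_VTrunc μ hβ, Measure.restrict_restrict measurableSet_Iic, inter_comm,
      Ici_inter_Iic]
  refine tendsto_atTop.2 fun b => ?_
  filter_upwards [h2.eventually (lt_mem_nhds (ENNReal.ofReal_lt_top (r := b)))] with x hx
  exact (ENNReal.ofReal_lt_ofReal_iff'.1 hx).1.le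

/-- Integration by parts: `h_β = V_β + x ^ β (1 - F)`. -/
lemma hTrunc_eq [IsProbabilityMeasure μ] (hμ : μ (Iio 0) = 0) {β : ℝ} (hβ : 0 < β) {x : ℝ}
    (hx : 0 ≤ x) : hTrunc μ β x = VTrunc μ β x + x ^ β * tail μ x := by
  have hnn : ∀ᵐ y ∂μ, 0 ≤ y := by
    rw [ae_iff]; simpa only [not_le] using! hμ
  have hmin : 0 ≤ᵐ[μ] fun y => min y x := hnn.mono fun y hy => le_min hy hx
  -- Layer cake formula for the β-th moment of min(y, x). Splitting this moment at y = x gives V +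
  -- x^β T; the level sets, which are empty from height x on, give h.
  have lay := lintegral_rpow_eq_lintegral_meas_lt_mul μ hmin (by fun_prop) hβ
  have hL : ∫⁻ y, ENNReal.ofReal (min y x ^ β) ∂μ =
      ENNReal.ofReal (VTrunc μ β x + x ^ β * tail μ x) := by
    have hcompl : μ.restrict (Iic x) = μ.restrict (Icc 0 x) := by
      refine Measure.restrict_congr_set ?_
      filter_upwards [hnn] with y hy
      exact propext ⟨fun h => ⟨hy, h⟩, fun h => h.2⟩
    rw [← lintegral_add_compl _ (measurableSet_Iic (a := x)), hcompl, compl_Iic,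
      ENNReal.ofReal_add (VTrunc_nonneg μ β x)
        (mul_nonneg (Real.rpow_nonneg hx _) (tail_nonneg μ x)), ofReal_VTrunc μ hβ]
    congr 1
    · exact setLIntegral_congr_fun measurableSet_Icc fun y hy => by simp only [min_eq_left hy.2]
    · rw [setLIntegral_congr_fun (g := fun _ => ENNReal.ofReal (x ^ β)) measurableSet_Ioi
        fun y hy => by simp only [min_eq_right (le_of_lt (mem_Ioi.1 hy))]]
      rw [setLIntegral_const, measure_Ioi_eq_tail, ENNReal.ofReal_mul (Real.rpow_nonneg hx _)]
  have hR : ENNReal.ofReal β * ∫⁻ t in Ioi 0, μ {y | t < min y x} * ENNReal.ofReal (t ^ (β - 1)) =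
      ENNReal.ofReal (hTrunc μ β x) := by
    rw [hTrunc, ENNReal.ofReal_mul hβ.le]
    congr 1
    rw [intervalIntegral.integral_of_le hx, integral_Ioc_eq_integral_Ioo,
      ofReal_integral_eq_lintegral_ofReal
        (((intervalIntegrable_iff_integrableOn_Ioo_of_le hx).1
          (intervalIntegrable_rpow_mul_tail μ hβ 0 x))),
      ← Ioi_inter_Iio, inter_comm, ← setLIntegral_indicator measurableSet_Iio]
    · refine setLIntegral_congr_fun measurableSet_Ioi fun t ht => ?_
      by_cases htx : t < x
      · have : {y | t < min y x} = Ioi t := by ext y; simp [htx]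
        simp only [this, indicator_of_mem (mem_Iio.2 htx), measure_Ioi_eq_tail]
        rw [mul_comm, ENNReal.ofReal_mul (Real.rpow_nonneg (le_of_lt ht) _)]
      · have : {y | t < min y x} = ∅ := by ext y; simp [htx]
        simp only [this, measure_empty, zero_mul, indicator_of_notMem (show t ∉ Iio x from htx)]
    · filter_upwards [self_mem_ae_restrict measurableSet_Ioo] with y hy
      exact mul_nonneg (Real.rpow_nonneg hy.1.le _) (tail_nonneg μ y)
  rw [hL, hR] at lay
  have h0 : 0 ≤ hTrunc μ β x := mul_nonneg hβ.le <|
    intervalIntegral.integral_nonneg hx fun y hy =>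
      mul_nonneg (Real.rpow_nonneg hy.1 _) (tail_nonneg μ y)
  exact ((ENNReal.ofReal_eq_ofReal_iff (add_nonneg (VTrunc_nonneg μ β x)
    (mul_nonneg (Real.rpow_nonneg hx _) (tail_nonneg μ x))) h0).1 lay).symm

lemma hTrunc_sub {β : ℝ} (hβ : 0 < β) (a b : ℝ) :
    hTrunc μ β b - hTrunc μ β a = β * ∫ y in a..b, y ^ (β - 1) * tail μ y := by
  rw [hTrunc, hTrunc, ← mul_sub, intervalIntegral.integral_interval_sub_left] <;>
  exact intervalIntegrable_rpow_mul_tail μ hβ _ _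

lemma continuous_hTrunc {β : ℝ} (hβ : 0 < β) : Continuous (hTrunc μ β) :=
  (intervalIntegral.continuous_primitive (intervalIntegrable_rpow_mul_tail μ hβ) 0).const_mul β

/-- Only a right derivative is available, because the tail is merely right-continuous; the version
of the fundamental theorem with right derivatives suffices below. -/
lemma hasDerivWithinAt_hTrunc {β : ℝ} (hβ : 0 < β) {x : ℝ} (hx : 0 < x) :
    HasDerivWithinAt (hTrunc μ β) (β * (x ^ (β - 1) * tail μ x)) (Ioi x) x := by
  have hm : Measurable fun y : ℝ => y ^ (β - 1) * tail μ y :=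
    (by fun_prop : Measurable fun y : ℝ => y ^ (β - 1)).mul (measurable_tail μ)
  refine HasDerivWithinAt.const_mul β (HasDerivWithinAt.mono
    (intervalIntegral.integral_hasDerivWithinAt_right (s := Ici x) (t := Ioi x)
      (intervalIntegrable_rpow_mul_tail μ hβ 0 x)
    hm.stronglyMeasurable.stronglyMeasurableAtFilter ?_) Ioi_subset_Ici_self)
  exact (Real.continuousAt_rpow_const _ _ (Or.inl hx.ne')).continuousWithinAt.mul
    (continuousWithinAt_tail μ x)

end Basic

/-! ### Karamata's theorem for h_β: conditions 1, 3 and 4 -/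

/-- Dominated convergence: φ is bounded by |c| + 1 far out, and u stays away from 0. It is applied
to φ = x h'/h. -/
lemma tendsto_integral_inv_mul_comp {φ : ℝ → ℝ} {c l : ℝ} (hm : Measurable φ)
    (hφ : Tendsto φ atTop (𝓝 c)) (hl : 0 < l) :
    Tendsto (fun x => ∫ u in (1 : ℝ)..l, u⁻¹ * φ (u * x)) atTop (𝓝 (c * Real.log l)) := by
  have h0 : (0 : ℝ) ∉ uIcc 1 l := notMem_uIcc_of_lt one_pos hl
  have hmin : 0 < min 1 l := lt_min one_pos hl
  have hlog : ∫ u in (1 : ℝ)..l, u⁻¹ * c = c * Real.log l := by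
    rw [intervalIntegral.integral_mul_const, integral_inv h0, div_one, mul_comm]
  rw [← hlog]
  refine intervalIntegral.tendsto_integral_filter_of_dominated_convergence
    (fun u => u⁻¹ * (|c| + 1)) ?_ ?_ ?_ ?_
  · exact Eventually.of_forall fun x =>
      (measurable_inv.mul (hm.comp (measurable_id.mul_const x))).aestronglyMeasurable
  · obtain ⟨X, hX⟩ := eventually_atTop.1
      (hφ.abs.eventually (gt_mem_nhds (lt_add_one |c|)))
    filter_upwards [eventually_ge_atTop (X / min 1 l), eventually_ge_atTop 0] with x hx hx0
    refine Eventually.of_forall fun u hu => ?_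
    have hu1 : min 1 l < u := hu.1
    have hu0 : 0 < u := hmin.trans hu1
    rw [norm_mul, Real.norm_of_nonneg (inv_nonneg.2 hu0.le), Real.norm_eq_abs]
    refine mul_le_mul_of_nonneg_left (hX _ ?_).le (inv_nonneg.2 hu0.le)
    rw [div_le_iff₀' hmin] at hx
    exact hx.trans (mul_le_mul_of_nonneg_right hu1.le hx0)
  · exact ((intervalIntegral.intervalIntegrable_inv (fun x hx h => h0 (h ▸ hx))
      continuousOn_id).mul_const _)
  · refine Eventually.of_forall fun u hu => ?_
    have hu0 : 0 < u := hmin.trans hu.1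
    exact (hφ.comp (tendsto_id.const_mul_atTop hu0)).const_mul _

lemma tendsto_rpow_sub_one_div (ρ : ℝ) {β : ℝ} (hβ : β ≠ 0) :
    Tendsto (fun l : ℝ => (l ^ ρ - 1) / (l ^ β - 1)) (𝓝[≠] 1) (𝓝 (ρ / β)) := by
  have h : ∀ r : ℝ, Tendsto (slope (fun l : ℝ => l ^ r) 1) (𝓝[≠] 1) (𝓝 r) := fun r => by
    simpa using hasDerivAt_iff_tendsto_slope.1
      (Real.hasDerivAt_rpow_const (x := 1) (p := r) (Or.inl one_ne_zero))
  refine ((h ρ).div (h β) hβ).congr' ?_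
  filter_upwards [self_mem_nhdsWithin] with l hl
  have : l - 1 ≠ 0 := sub_ne_zero.2 hl
  simp only [Pi.div_apply, slope_def_field, Real.one_rpow]
  exact div_div_div_cancel_right₀ this _ _

section Truncated

variable {μ : Measure ℝ} {β ρ : ℝ}

lemma VTrunc_le_hTrunc [IsProbabilityMeasure μ] (hμ : μ (Iio 0) = 0) (hβ : 0 < β) {x : ℝ}
    (hx : 0 ≤ x) : VTrunc μ β x ≤ hTrunc μ β x := by
  rw [hTrunc_eq μ hμ hβ hx]
  exact le_add_of_nonneg_right (mul_nonneg (Real.rpow_nonneg hx _) (tail_nonneg μ x))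

lemma tendsto_hTrunc_atTop [IsProbabilityMeasure μ] (hμ : μ (Iio 0) = 0) (hβ : 0 < β)
    (hV : Tendsto (VTrunc μ β) atTop atTop) : Tendsto (hTrunc μ β) atTop atTop := by
  refine tendsto_atTop_mono' atTop ?_ hV
  filter_upwards [eventually_ge_atTop 0] with x hx using VTrunc_le_hTrunc hμ hβ hx

/-- Replacing the tail on the interval by its value at a. The inequality also holds for b < a: the
tail is then underestimated, but the orientation reverses the sign. This yields both sides of the
squeeze in `tendsto_of_regularlyVarying_hTrunc`. -/
lemma hTrunc_sub_le (hβ : 0 < β) {a b : ℝ} (ha : 0 ≤ a) (hb : 0 ≤ b) :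
    hTrunc μ β b - hTrunc μ β a ≤ tail μ a * (b ^ β - a ^ β) := by
  rw [hTrunc_sub μ hβ, ← integral_rpow_sub_one hβ, mul_left_comm]
  refine mul_le_mul_of_nonneg_left ?_ hβ.le
  rw [← intervalIntegral.integral_const_mul]
  have hI : ∀ a b : ℝ, IntervalIntegrable (fun y => tail μ a * y ^ (β - 1)) volume a b :=
    fun a b => (intervalIntegral.intervalIntegrable_rpow' (by linarith)).const_mul _
  rcases le_total a b with h | h
  · refine intervalIntegral.integral_mono_on h (intervalIntegrable_rpow_mul_tail μ hβ a b)
      (hI a b) fun y hy => ?_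
    rw [mul_comm]
    exact mul_le_mul_of_nonneg_right (tail_antitone μ hy.1) (Real.rpow_nonneg (ha.trans hy.1) _)
  · rw [intervalIntegral.integral_symm b a, intervalIntegral.integral_symm b a, neg_le_neg_iff]
    refine intervalIntegral.integral_mono_on h (hI a b).symm
      (intervalIntegrable_rpow_mul_tail μ hβ b a) fun y hy => ?_
    rw [mul_comm]
    exact mul_le_mul_of_nonneg_left (tail_antitone μ hy.2) (Real.rpow_nonneg (hb.trans hy.1) _)

lemma regularlyVarying_hTrunc_of_tendsto (hβ : 0 < β)
    (hh : Tendsto (hTrunc μ β) atTop atTop)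
    (h : Tendsto (fun x => tail μ x * x ^ β / hTrunc μ β x) atTop (𝓝 (ρ / β))) :
    RegularlyVarying (hTrunc μ β) ρ := by
  obtain ⟨X, hX⟩ := eventually_atTop.1 ((hh.eventually_gt_atTop 0).and (eventually_gt_atTop 0))
  have hm : Measurable (hTrunc μ β) := (continuous_hTrunc μ hβ).measurable
  refine ⟨⟨X, hm.comp measurable_subtype_coe, fun x hx => (hX x hx).1⟩, fun l hl => ?_⟩
  have hφm : Measurable fun x => β * (tail μ x * x ^ β / hTrunc μ β x) :=
    ((((measurable_tail μ).mul (by fun_prop)).div hm).const_mul β)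
  have hφ : Tendsto (fun x => β * (tail μ x * x ^ β / hTrunc μ β x)) atTop (𝓝 ρ) := by
    simpa [mul_div_cancel₀ _ hβ.ne'] using h.const_mul β
  -- The integral here is log h(lx) - log h(x), written with y = ux; exponentiating its limit ρ log
  -- l gives l^ρ.
  have key := tendsto_integral_inv_mul_comp hφm hφ hl
  have hexp := (Real.continuous_exp.tendsto _).comp key
  rw [mul_comm, ← Real.rpow_def_of_pos hl] at hexp
  refine hexp.congr' ?_
  have hmul : Tendsto (fun x : ℝ => l * x) atTop atTop := tendsto_id.const_mul_atTop hl
  filter_upwards [eventually_ge_atTop X, hmul.eventually_ge_atTop X] with x hx hlx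
  have hle : ∀ y ∈ uIcc x (l * x), X ≤ y := fun y hy => (le_min hx hlx).trans hy.1
  have hcont : ContinuousOn (fun y => (hTrunc μ β y)⁻¹) (uIcc x (l * x)) :=
    (continuous_hTrunc μ hβ).continuousOn.inv₀ fun y hy => (hX y (hle y hy)).1.ne'
  have ftc : ∫ y in x..l * x, β * (y ^ (β - 1) * tail μ y) / hTrunc μ β y
      = Real.log (hTrunc μ β (l * x)) - Real.log (hTrunc μ β x) := by
    refine intervalIntegral.integral_eq_sub_of_hasDeriv_right
      (f := fun y => Real.log (hTrunc μ β y)) ?_ (fun y hy => ?_) ?_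
    · exact (continuous_hTrunc μ hβ).continuousOn.log fun y hy => (hX y (hle y hy)).1.ne'
    · have := hX y (hle y (Ioo_subset_Icc_self hy))
      exact (hasDerivWithinAt_hTrunc μ hβ this.2).log this.1.ne'
    · exact ((intervalIntegrable_rpow_mul_tail μ hβ _ _).const_mul β).mul_continuousOn hcont
  have hx0 : 0 < x := (hX x hx).2
  have hsub := intervalIntegral.smul_integral_comp_mul_right (a := 1) (b := l)
    (fun y => β * (y ^ (β - 1) * tail μ y) / hTrunc μ β y) x
  rw [one_mul, ftc, smul_eq_mul, ← intervalIntegral.integral_const_mul] at hsub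
  have hcongr : ∫ u in (1 : ℝ)..l,
      u⁻¹ * (β * (tail μ (u * x) * (u * x) ^ β / hTrunc μ β (u * x))) =
      Real.log (hTrunc μ β (l * x)) - Real.log (hTrunc μ β x) := by
    rw [← hsub]
    refine intervalIntegral.integral_congr fun u hu => ?_
    have hu0 : 0 < u := (lt_min one_pos hl).trans_le hu.1
    rw [Real.rpow_sub_one (mul_pos hu0 hx0).ne']
    field_simp
  simp only [Function.comp_apply, hcongr]
  rw [Real.exp_sub, Real.exp_log (hX _ hlx).1, Real.exp_log (hX _ hx).1]

lemma tendsto_of_regularlyVarying_hTrunc (hβ : 0 < β) (h : RegularlyVarying (hTrunc μ β) ρ) :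
    Tendsto (fun x => tail μ x * x ^ β / hTrunc μ β x) atTop (𝓝 (ρ / β)) := by
  obtain ⟨⟨X, -, hX⟩, hlim⟩ := h
  have hineq : ∀ l : ℝ, 0 < l → ∀ x : ℝ, X ≤ x → 0 < x →
      hTrunc μ β (l * x) / hTrunc μ β x - 1 ≤
        tail μ x * x ^ β / hTrunc μ β x * (l ^ β - 1) := fun l hl x hx hx0 => by
    have := hTrunc_sub_le (μ := μ) hβ hx0.le (mul_pos hl hx0).le
    have hp := hX x hx
    rw [Real.mul_rpow hl.le hx0.le] at this
    rw [div_sub_one hp.ne', div_mul_eq_mul_div]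
    refine (div_le_div_iff_of_pos_right hp).2 (this.trans_eq (by ring))
  have hlim' : ∀ l : ℝ, 0 < l → Tendsto
      (fun x => (hTrunc μ β (l * x) / hTrunc μ β x - 1) / (l ^ β - 1)) atTop
      (𝓝 ((l ^ ρ - 1) / (l ^ β - 1))) := fun l hl => ((hlim l hl).sub_const 1).div_const _
  have hT := tendsto_rpow_sub_one_div ρ hβ.ne'
  -- Dividing `hineq` by l^β - 1 bounds the ratio from below when l > 1 and from above when l < 1.
  -- Both bounds tend to (l^ρ - 1)/(l^β - 1) as x → ∞, which is close to ρ/β for l near 1.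
  refine tendsto_order.2 ⟨fun a ha => ?_, fun a ha => ?_⟩
  · obtain ⟨l, hl, hl1⟩ := (((hT.mono_left (nhdsGT_le_nhdsNE 1)).eventually
      (lt_mem_nhds ha)).and self_mem_nhdsWithin).exists
    have hl0 : 0 < l := one_pos.trans hl1
    have hp : 0 < l ^ β - 1 := sub_pos.2 (Real.one_lt_rpow hl1 hβ)
    filter_upwards [(hlim' l hl0).eventually (lt_mem_nhds hl), eventually_ge_atTop X,
      eventually_gt_atTop 0] with x h1 h2 h3
    exact h1.trans_le ((div_le_iff₀ hp).2 (hineq l hl0 x h2 h3))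
  · obtain ⟨l, ⟨hl, hl1⟩, hl0⟩ := ((((hT.mono_left (nhdsLT_le_nhdsNE 1)).eventually
      (gt_mem_nhds ha)).and self_mem_nhdsWithin).and
        (mem_nhdsWithin_of_mem_nhds (Ioi_mem_nhds one_pos))).exists
    replace hl0 : 0 < l := hl0
    replace hl1 : l < 1 := hl1
    have hp : l ^ β - 1 < 0 := sub_neg.2 (Real.rpow_lt_one hl0.le hl1 hβ)
    filter_upwards [(hlim' l hl0).eventually (gt_mem_nhds hl), eventually_ge_atTop X,
      eventually_gt_atTop 0] with x h1 h2 h3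
    exact ((le_div_iff_of_neg hp).2 (hineq l hl0 x h2 h3)).trans_lt h1

/-- The substitution y = lu turns h(lx) into an integral over [0, x] whose integrand, divided by
that of h(x), tends to l · l^(β-1) · l^(ρ-β) = l^ρ. Since h diverges, the Stolz–Cesàro lemma
applies. -/
lemma regularlyVarying_hTrunc_of_tail (hβ : 0 < β) (hh : Tendsto (hTrunc μ β) atTop atTop)
    (h : RegularlyVarying (tail μ) (ρ - β)) : RegularlyVarying (hTrunc μ β) ρ := by
  obtain ⟨⟨X, -, hX⟩, hlim⟩ := h
  obtain ⟨Y, hY⟩ := eventually_atTop.1 (hh.eventually_gt_atTop 0)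
  refine ⟨⟨Y, (continuous_hTrunc μ hβ).measurable.comp measurable_subtype_coe,
    fun x hx => hY x hx⟩, fun l hl => ?_⟩
  have hI := intervalIntegrable_rpow_mul_tail μ hβ
  have key := tendsto_integral_div_integral (c := l ^ ρ)
    (f := fun u => l * ((l * u) ^ (β - 1) * tail μ (l * u)))
    (g := fun u => u ^ (β - 1) * tail μ u) (fun x _ => ?_) (fun x _ => hI 0 x) ?_ ?_ ?_
  · refine key.congr fun x => ?_
    rw [intervalIntegral.integral_const_mul, ← smul_eq_mul,
      intervalIntegral.smul_integral_comp_mul_left (fun u => u ^ (β - 1) * tail μ u), mul_zero,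
      hTrunc, hTrunc, mul_div_mul_left _ _ hβ.ne']
  · have := (hI (l * 0) (l * x)).comp_mul_left (c := l)
    rw [mul_div_cancel_left₀ _ hl.ne', mul_div_cancel_left₀ _ hl.ne'] at this
    exact this.const_mul l
  · filter_upwards [eventually_ge_atTop X, eventually_gt_atTop 0] with x hx hx0
    exact mul_pos (Real.rpow_pos_of_pos hx0 _) (hX x hx)
  · exact (tendsto_const_mul_atTop_of_pos hβ).1 hh
  · have := (hlim l hl).const_mul (l ^ β)
    rw [← Real.rpow_add hl, add_sub_cancel] at this
    refine this.congr' ?_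
    filter_upwards [eventually_ge_atTop X, eventually_gt_atTop 0] with x hx hx0
    have h1 : 0 < x ^ (β - 1) := Real.rpow_pos_of_pos hx0 _
    have h2 := hX x hx
    rw [Real.mul_rpow hl.le hx0.le, Real.rpow_sub_one hl.ne']
    field_simp

/-! ### From V_β to h_β, and from h_β to the tail -/

/-- The quantity is a mean of the tail with weight y^(β-1), and the tail vanishes at infinity. This
removes the boundary term when x^(-β) h is written as an integral over [x, ∞). -/
lemma tendsto_hTrunc_div_rpow (hβ : 0 < β) :
    Tendsto (fun x => x ^ (-β) * hTrunc μ β x) atTop (𝓝 0) := by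
  have hp : ∀ x : ℝ, ∫ y in (0 : ℝ)..x, y ^ (β - 1) = x ^ β / β := fun x => by
    rw [eq_div_iff hβ.ne', mul_comm, integral_rpow_sub_one hβ, Real.zero_rpow hβ.ne', sub_zero]
  have key := tendsto_integral_div_integral (c := 0) (f := fun u => u ^ (β - 1) * tail μ u)
    (g := fun u => u ^ (β - 1)) (fun x _ => intervalIntegrable_rpow_mul_tail μ hβ 0 x)
    (fun x _ => intervalIntegral.intervalIntegrable_rpow' (by linarith)) ?_ ?_ ?_
  · refine key.congr' ?_
    filter_upwards [eventually_gt_atTop 0] with x hx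
    have : 0 < x ^ β := Real.rpow_pos_of_pos hx _
    rw [hp, hTrunc, Real.rpow_neg hx.le]
    field_simp
  · filter_upwards [eventually_gt_atTop 0] with x hx using Real.rpow_pos_of_pos hx _
  · simp only [hp]
    exact (tendsto_rpow_atTop hβ).atTop_div_const hβ
  · refine (tendsto_tail_atTop μ).congr' ?_
    filter_upwards [eventually_gt_atTop 0] with x hx
    rw [mul_div_cancel_left₀ _ (Real.rpow_pos_of_pos hx _).ne']

lemma intervalIntegrable_rpow_mul_VTrunc [IsProbabilityMeasure μ] (hβ : 0 < β) (r : ℝ) {a b : ℝ}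
    (ha : 0 < a) (hb : 0 < b) : IntervalIntegrable (fun y => y ^ r * VTrunc μ β y) volume a b :=
  (VTrunc_mono μ hβ).intervalIntegrable.continuousOn_mul fun _ hy =>
    (Real.continuousAt_rpow_const _ _
      (Or.inl ((lt_min ha hb).trans_le hy.1).ne')).continuousWithinAt

/-- The derivative of y^(-β) h is -β y^(-β-1) (h - y^β T), and the bracket is V by integration by
parts. -/
lemma integral_rpow_mul_VTrunc [IsProbabilityMeasure μ] (hμ : μ (Iio 0) = 0) (hβ : 0 < β) {a b : ℝ}
    (ha : 0 < a) (hb : 0 < b) : β * ∫ y in a..b, y ^ (-β - 1) * VTrunc μ β y =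
      a ^ (-β) * hTrunc μ β a - b ^ (-β) * hTrunc μ β b := by
  have hpos : ∀ y ∈ uIcc a b, 0 < y := fun y hy => (lt_min ha hb).trans_le hy.1
  have ftc : ∫ y in a..b, -β * (y ^ (-β - 1) * VTrunc μ β y) =
      b ^ (-β) * hTrunc μ β b - a ^ (-β) * hTrunc μ β a := by
    refine intervalIntegral.integral_eq_sub_of_hasDeriv_right
      (f := fun y => y ^ (-β) * hTrunc μ β y) ?_ (fun y hy => ?_) ?_
    · refine ContinuousOn.mul (fun y hy => ?_) (continuous_hTrunc μ hβ).continuousOn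
      exact (Real.continuousAt_rpow_const _ _ (Or.inl (hpos y hy).ne')).continuousWithinAt
    · have hy0 := hpos y (Ioo_subset_Icc_self hy)
      refine ((Real.hasDerivAt_rpow_const (p := -β) (Or.inl hy0.ne')).hasDerivWithinAt.mul
        (hasDerivWithinAt_hTrunc μ hβ hy0)).congr_deriv ?_
      rw [hTrunc_eq μ hμ hβ hy0.le, Real.rpow_sub_one hy0.ne', Real.rpow_sub_one hy0.ne',
        Real.rpow_neg hy0.le]
      have : 0 < y ^ β := Real.rpow_pos_of_pos hy0 _
      field_simp
      ring
    · exact (intervalIntegrable_rpow_mul_VTrunc hβ _ ha hb).const_mul _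
  rw [intervalIntegral.integral_const_mul] at ftc
  linarith

lemma regularlyVarying_hTrunc_of_VTrunc [IsProbabilityMeasure μ] (hμ : μ (Iio 0) = 0) (hβ : 0 < β)
    (hh : Tendsto (hTrunc μ β) atTop atTop) (h : RegularlyVarying (VTrunc μ β) ρ) :
    RegularlyVarying (hTrunc μ β) ρ := by
  obtain ⟨⟨X, -, hX⟩, hlim⟩ := h
  obtain ⟨Y, hY⟩ := eventually_atTop.1 (hh.eventually_gt_atTop 0)
  refine ⟨⟨Y, (continuous_hTrunc μ hβ).measurable.comp measurable_subtype_coe,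
    fun x hx => hY x hx⟩, fun l hl => ?_⟩
  rw [Metric.tendsto_atTop]
  intro ε hε
  obtain ⟨Z, hZ⟩ := eventually_atTop.1 (((hlim l hl).eventually
    (Metric.ball_mem_nhds _ (half_pos hε))).and
      ((eventually_ge_atTop X).and ((eventually_ge_atTop Y).and (eventually_gt_atTop 0))))
  refine ⟨Z, fun x hx => ?_⟩
  set G : ℝ → ℝ := fun x => x ^ (-β) * hTrunc μ β x with hG
  have hx0 : 0 < x := (hZ x hx).2.2.2
  -- The comparison is made on a finite interval [x, b], where V(lu) is within ε/2 · V(u) of l^ρ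
  -- V(u); then b → ∞ eliminates G(b) and G(lb).
  have hb : ∀ b, x ≤ b → |(G (l * x) - G (l * b)) - l ^ (-β) * l ^ ρ * (G x - G b)| ≤
      l ^ (-β) * (ε / 2) * (G x - G b) := fun b hxb => by
    have hb0 : 0 < b := hx0.trans_le hxb
    have h1 : G (l * x) - G (l * b) =
        β * l ^ (-β) * ∫ u in x..b, u ^ (-β - 1) * VTrunc μ β (l * u) := by
      rw [hG, ← integral_rpow_mul_VTrunc hμ hβ (mul_pos hl hx0) (mul_pos hl hb0),
        ← intervalIntegral.smul_integral_comp_mul_left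
          (fun y => y ^ (-β - 1) * VTrunc μ β y), smul_eq_mul, mul_assoc]
      congr 1
      rw [← intervalIntegral.integral_const_mul, ← intervalIntegral.integral_const_mul]
      refine intervalIntegral.integral_congr fun u hu => ?_
      have hu0 : 0 < u := (lt_min hx0 hb0).trans_le hu.1
      rw [Real.mul_rpow hl.le hu0.le, Real.rpow_sub_one hl.ne']
      field_simp
    have h2 : G x - G b = β * ∫ u in x..b, u ^ (-β - 1) * VTrunc μ β u :=
      (integral_rpow_mul_VTrunc hμ hβ hx0 hb0).symm
    have hI := intervalIntegrable_rpow_mul_VTrunc (μ := μ) hβ (-β - 1) hx0 hb0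
    have hI' : IntervalIntegrable (fun u => u ^ (-β - 1) * VTrunc μ β (l * u)) volume x b := by
      refine IntervalIntegrable.continuousOn_mul (f := fun u => VTrunc μ β (l * u)) ?_
        fun y hy => (Real.continuousAt_rpow_const _ _
          (Or.inl ((lt_min hx0 hb0).trans_le hy.1).ne')).continuousWithinAt
      refine Monotone.intervalIntegrable fun u v huv => VTrunc_mono μ hβ ?_
      exact mul_le_mul_of_nonneg_left huv hl.le
    have h3 : |∫ u in x..b, (u ^ (-β - 1) * VTrunc μ β (l * u) -
        l ^ ρ * (u ^ (-β - 1) * VTrunc μ β u))| ≤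
        ε / 2 * ∫ u in x..b, u ^ (-β - 1) * VTrunc μ β u := by
      rw [← intervalIntegral.integral_const_mul, ← Real.norm_eq_abs]
      refine intervalIntegral.norm_integral_le_of_norm_le hxb
        (Eventually.of_forall fun u hu => ?_) (hI.const_mul _)
      obtain ⟨k1, k2, -, k3⟩ := hZ u (hx.trans hu.1.le)
      have k4 := hX u k2
      have k5 : 0 < u ^ (-β - 1) := Real.rpow_pos_of_pos k3 _
      rw [Real.dist_eq] at k1
      have : u ^ (-β - 1) * VTrunc μ β (l * u) - l ^ ρ * (u ^ (-β - 1) * VTrunc μ β u) =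
          (VTrunc μ β (l * u) / VTrunc μ β u - l ^ ρ) * (u ^ (-β - 1) * VTrunc μ β u) := by
        field_simp
      rw [this, Real.norm_eq_abs, abs_mul, abs_of_pos (mul_pos k5 k4)]
      exact mul_le_mul_of_nonneg_right k1.le (mul_pos k5 k4).le
    rw [intervalIntegral.integral_sub hI' (hI.const_mul _),
      intervalIntegral.integral_const_mul] at h3
    have hc : 0 < l ^ (-β) * β := mul_pos (Real.rpow_pos_of_pos hl _) hβ
    rw [h1, h2]
    generalize (∫ u in x..b, u ^ (-β - 1) * VTrunc μ β (l * u)) = p at h3 ⊢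
    generalize (∫ u in x..b, u ^ (-β - 1) * VTrunc μ β u) = q at h3 ⊢
    calc |β * l ^ (-β) * p - l ^ (-β) * l ^ ρ * (β * q)|
        = l ^ (-β) * β * |p - l ^ ρ * q| := by
          rw [← abs_of_pos hc, ← abs_mul]
          congr 1
          ring
      _ ≤ l ^ (-β) * β * (ε / 2 * q) := mul_le_mul_of_nonneg_left h3 hc.le
      _ = l ^ (-β) * (ε / 2) * (β * q) := by ring
  have hG0 : Tendsto G atTop (𝓝 0) := tendsto_hTrunc_div_rpow hβ
  have hGl : Tendsto (fun b => G (l * b)) atTop (𝓝 0) :=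
    hG0.comp (tendsto_id.const_mul_atTop hl)
  have hfin : |G (l * x) - l ^ (-β) * l ^ ρ * G x| ≤ l ^ (-β) * (ε / 2) * G x := by
    have t1 := ((hGl.const_sub (G (l * x))).sub
      ((hG0.const_sub (G x)).const_mul (l ^ (-β) * l ^ ρ))).abs
    have t2 := (hG0.const_sub (G x)).const_mul (l ^ (-β) * (ε / 2))
    rw [sub_zero, sub_zero] at t1
    rw [sub_zero] at t2
    exact le_of_tendsto_of_tendsto t1 t2 ((eventually_ge_atTop x).mono hb)
  have hhx : 0 < hTrunc μ β x := hY x (hZ x hx).2.2.1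
  have hc : 0 < l ^ (-β) * x ^ (-β) :=
    mul_pos (Real.rpow_pos_of_pos hl _) (Real.rpow_pos_of_pos hx0 _)
  have hfac : G (l * x) - l ^ (-β) * l ^ ρ * G x =
      l ^ (-β) * x ^ (-β) * (hTrunc μ β (l * x) - l ^ ρ * hTrunc μ β x) := by
    simp only [hG]
    rw [Real.mul_rpow hl.le hx0.le]
    ring
  have hfac' : l ^ (-β) * (ε / 2) * G x = l ^ (-β) * x ^ (-β) * (ε / 2 * hTrunc μ β x) := by
    simp only [hG]
    ring
  rw [hfac, hfac', abs_mul, abs_of_pos hc, mul_le_mul_iff_right₀ hc] at hfin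
  rw [Real.dist_eq, div_sub' hhx.ne', abs_div, abs_of_pos hhx, div_lt_iff₀ hhx,
    mul_comm _ (l ^ ρ)]
  exact hfin.trans_lt (mul_lt_mul_of_pos_right (half_lt_self hε) hhx)

lemma regularlyVarying_hTrunc_iff (hβ : 0 < β) (hh : Tendsto (hTrunc μ β) atTop atTop) :
    RegularlyVarying (hTrunc μ β) ρ ↔
      Tendsto (fun x => tail μ x * x ^ β / hTrunc μ β x) atTop (𝓝 (ρ / β)) :=
  ⟨tendsto_of_regularlyVarying_hTrunc hβ, regularlyVarying_hTrunc_of_tendsto hβ hh⟩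

/-- The limit ρ/β in condition 4 is positive, so the tail is comparable to x^(-β) h. For ρ = 0 this
comparison is lost. -/
lemma regularlyVarying_tail_of_hTrunc (hβ : 0 < β) (hρ : 0 < ρ)
    (h : RegularlyVarying (hTrunc μ β) ρ) : RegularlyVarying (tail μ) (ρ - β) := by
  rw [sub_eq_add_neg]
  refine h.of_tendsto_div (X₀ := 0) ((measurable_tail μ).comp measurable_subtype_coe)
    (div_pos hρ hβ) ((tendsto_of_regularlyVarying_hTrunc hβ h).congr' ?_)
  filter_upwards [eventually_gt_atTop 0] with x hx
  rw [Real.rpow_neg hx.le, div_mul_eq_div_div, div_inv_eq_mul]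

end Truncated

/-! ### Condition 2 with ρ = β and the de Haan class -/

/-- If the dyadic increments of a nonnegative, monotone, unbounded function `V` satisfy
`D (l x) / D x → A`, then so does `V`. -/
lemma tendsto_div_of_tendsto_dyadic_increment {V : ℝ → ℝ} (hmono : Monotone V)
    (hnn : ∀ x, 0 ≤ V x) (hinf : Tendsto V atTop atTop) {l A : ℝ} (hl : 0 < l) (hA : 0 < A)
    (hpos : ∀ᶠ x in atTop, 0 < V x - V (x / 2))
    (hD : Tendsto (fun x => (V (l * x) - V (l * x / 2)) / (V x - V (x / 2))) atTop (𝓝 A)) :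
    Tendsto (fun x => V (l * x) / V x) atTop (𝓝 A) := by
  -- Beyond X each dyadic increment of V(l ·) is at most a times that of V. Summing along x, x/2,
  -- x/4, … until X is passed leaves an error independent of x. The induction runs over the number
  -- of halvings.
  have hup : ∀ a, A < a → ∃ K, ∀ᶠ x in atTop, V (l * x) ≤ a * V x + K := fun a ha => by
    obtain ⟨X, hX⟩ := eventually_atTop.1
      ((hpos.and (hD.eventually (gt_mem_nhds ha))).and (eventually_gt_atTop 0))
    have hX0 : 0 < X := (hX X le_rfl).2
    have ha0 : 0 < a := hA.trans ha
    have hind : ∀ n : ℕ, ∀ x, x ≤ X * 2 ^ n → V (l * x) ≤ a * V x + V (l * X) := by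
      intro n
      induction n with
      | zero =>
        intro x hx
        rw [pow_zero, mul_one] at hx
        have := hmono (mul_le_mul_of_nonneg_left hx hl.le)
        have := mul_nonneg ha0.le (hnn x)
        linarith
      | succ n ih =>
        intro x hx
        rcases le_total x X with h | h
        · have := hmono (mul_le_mul_of_nonneg_left h hl.le)
          have := mul_nonneg ha0.le (hnn x)
          linarith
        · have h1 := ih (x / 2) (by rw [pow_succ] at hx; linarith)
          obtain ⟨⟨h2, h3⟩, -⟩ := hX x h
          rw [div_lt_iff₀ h2] at h3
          rw [← mul_div_assoc] at h1
          linarith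
    refine ⟨V (l * X), (eventually_gt_atTop 0).mono fun x _ => ?_⟩
    obtain ⟨n, hn⟩ := pow_unbounded_of_one_lt (x / X) one_lt_two
    exact hind n x ((div_le_iff₀' hX0).1 hn.le)
  have hlo : ∀ a, 0 < a → a < A → ∃ K, ∀ᶠ x in atTop, a * V x - K ≤ V (l * x) :=
      fun a ha0 ha => by
    obtain ⟨X, hX⟩ := eventually_atTop.1
      ((hpos.and (hD.eventually (lt_mem_nhds ha))).and (eventually_gt_atTop 0))
    have hX0 : 0 < X := (hX X le_rfl).2
    have hind : ∀ n : ℕ, ∀ x, x ≤ X * 2 ^ n → a * V x - a * V X ≤ V (l * x) := by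
      intro n
      induction n with
      | zero =>
        intro x hx
        rw [pow_zero, mul_one] at hx
        have := mul_le_mul_of_nonneg_left (hmono hx) ha0.le
        linarith [hnn (l * x)]
      | succ n ih =>
        intro x hx
        rcases le_total x X with h | h
        · have := mul_le_mul_of_nonneg_left (hmono h) ha0.le
          linarith [hnn (l * x)]
        · have h1 := ih (x / 2) (by rw [pow_succ] at hx; linarith)
          obtain ⟨⟨h2, h3⟩, -⟩ := hX x h
          rw [lt_div_iff₀ h2] at h3
          rw [← mul_div_assoc] at h1
          linarith
    refine ⟨a * V X, (eventually_gt_atTop 0).mono fun x _ => ?_⟩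
    obtain ⟨n, hn⟩ := pow_unbounded_of_one_lt (x / X) one_lt_two
    exact hind n x ((div_le_iff₀' hX0).1 hn.le)
  refine tendsto_order.2 ⟨fun a ha => ?_, fun a ha => ?_⟩
  -- The gap between a and b absorbs K because V tends to infinity; the maximum with 0 keeps b
  -- positive, as `hlo` requires.
  · obtain ⟨b, hb1, hb2⟩ := exists_between (max_lt ha hA)
    obtain ⟨K, hK⟩ := hlo b ((le_max_right _ _).trans_lt hb1) hb2
    have hab : 0 < b - a := sub_pos.2 ((le_max_left _ _).trans_lt hb1)
    filter_upwards [hK, hinf.eventually_gt_atTop (K / (b - a)), hinf.eventually_gt_atTop 0]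
      with x h1 h2 h3
    rw [div_lt_iff₀ hab] at h2
    rw [lt_div_iff₀ h3]
    linarith
  · obtain ⟨b, hb1, hb2⟩ := exists_between ha
    obtain ⟨K, hK⟩ := hup b hb1
    have hab : 0 < a - b := sub_pos.2 hb2
    filter_upwards [hK, hinf.eventually_gt_atTop (K / (a - b)), hinf.eventually_gt_atTop 0]
      with x h1 h2 h3
    rw [div_lt_iff₀ hab] at h2
    rw [div_lt_iff₀ h3]
    linarith

section Truncated

variable {μ : Measure ℝ} [IsProbabilityMeasure μ] {β ρ : ℝ}

lemma tail_eq_sub (hμ : μ (Iio 0) = 0) (hβ : 0 < β) {x : ℝ} (hx : 0 < x) :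
    tail μ x = x ^ (-β) * hTrunc μ β x - x ^ (-β) * VTrunc μ β x := by
  have : 0 < x ^ β := Real.rpow_pos_of_pos hx _
  rw [hTrunc_eq μ hμ hβ hx.le, Real.rpow_neg hx.le]
  field_simp
  ring

lemma deHaanClass_tail_of_VTrunc (hμ : μ (Iio 0) = 0) (hβ : 0 < β)
    (h : RegularlyVarying (VTrunc μ β) β) : DeHaanClass (tail μ) := by
  have hVm : Measurable (VTrunc μ β) := (VTrunc_mono μ hβ).measurable
  obtain ⟨⟨X, -, hX⟩, hlim⟩ := id h
  have hSV : SlowlyVarying fun x => x ^ (-β) * VTrunc μ β x := by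
    have := h.of_tendsto_div (f := fun x => x ^ (-β) * VTrunc μ β x) (a := -β) (X₀ := 0)
      (((by fun_prop : Measurable fun x : ℝ => x ^ (-β)).mul hVm).comp measurable_subtype_coe)
      one_pos ?_
    · rwa [add_neg_cancel] at this
    · refine tendsto_const_nhds.congr' ?_
      filter_upwards [eventually_ge_atTop X, eventually_gt_atTop 0] with x hx hx0
      exact (div_self (mul_pos (Real.rpow_pos_of_pos hx0 _) (hX x hx)).ne').symm
  refine ⟨_, hSV, -β, neg_ne_zero.2 hβ.ne', fun l hl => ?_⟩
  have hmin : 0 < min 1 l := lt_min one_pos hl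
  have h0 : (0 : ℝ) ∉ uIcc 1 l := notMem_uIcc_of_lt one_pos hl
  have hint : Tendsto (fun x => ∫ u in (1 : ℝ)..l, u ^ (-β - 1) *
      (VTrunc μ β (u * x) / VTrunc μ β x)) atTop (𝓝 (Real.log l)) := by
    have hlog : ∫ u in (1 : ℝ)..l, u⁻¹ = Real.log l := by rw [integral_inv h0, div_one]
    rw [← hlog]
    refine intervalIntegral.tendsto_integral_filter_of_dominated_convergence
      -- Since V is monotone, V(ux)/V(x) is at most its value at u = max 1 l, which converges to
      -- (max 1 l)^β.
      (fun u => u ^ (-β - 1) * ((max 1 l) ^ β + 1)) ?_ ?_ ?_ ?_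
    · exact Eventually.of_forall fun x =>
        ((by fun_prop : Measurable fun u : ℝ => u ^ (-β - 1)).mul
          ((hVm.comp (measurable_id.mul_const x)).div_const _)).aestronglyMeasurable
    · filter_upwards [(hlim (max 1 l) (hl.trans_le (le_max_right _ _))).eventually
        (gt_mem_nhds (lt_add_one _)), eventually_ge_atTop X, eventually_ge_atTop 0]
        with x h1 h2 h3
      refine Eventually.of_forall fun u hu => ?_
      have hu0 : 0 < u := hmin.trans hu.1
      have hp := hX x h2
      rw [Real.norm_of_nonneg (mul_nonneg (Real.rpow_nonneg hu0.le _)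
        (div_nonneg (VTrunc_nonneg _ _ _) hp.le))]
      refine mul_le_mul_of_nonneg_left (le_trans ?_ h1.le) (Real.rpow_nonneg hu0.le _)
      exact (div_le_div_iff_of_pos_right hp).2
        (VTrunc_mono μ hβ (mul_le_mul_of_nonneg_right hu.2 h3))
    · exact (intervalIntegral.intervalIntegrable_rpow (Or.inr h0)).mul_const _
    · refine Eventually.of_forall fun u hu => ?_
      have hu0 : 0 < u := hmin.trans hu.1
      have := (hlim u hu0).const_mul (u ^ (-β - 1))
      rwa [← Real.rpow_add hu0, show -β - 1 + β = -1 by ring, Real.rpow_neg_one] at this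
  have hSVl := hSV.2 l hl
  rw [Real.rpow_zero] at hSVl
  -- After division by x^(-β) V(x), the increment of x^(-β) h contributes -β log l, and that of
  -- x^(-β) V contributes 0 by slow variation.
  have key := (hint.const_mul (-β)).sub (hSVl.sub_const 1)
  rw [sub_self, sub_zero] at key
  refine key.congr' ?_
  filter_upwards [eventually_ge_atTop X, eventually_gt_atTop 0] with x hx hx0
  have hp := hX x hx
  have hxp : 0 < x ^ (-β) := Real.rpow_pos_of_pos hx0 _
  have hlx0 : 0 < l * x := mul_pos hl hx0
  have hsub := intervalIntegral.smul_integral_comp_mul_right (a := 1) (b := l)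
    (fun y => y ^ (-β - 1) * VTrunc μ β y) x
  have hid := integral_rpow_mul_VTrunc hμ hβ hx0 hlx0
  rw [one_mul, smul_eq_mul, ← intervalIntegral.integral_const_mul] at hsub
  have hI : (x ^ (-β) * VTrunc μ β x) * ∫ u in (1 : ℝ)..l, u ^ (-β - 1) *
      (VTrunc μ β (u * x) / VTrunc μ β x) = ∫ y in x..l * x, y ^ (-β - 1) * VTrunc μ β y := by
    rw [← hsub, ← intervalIntegral.integral_const_mul]
    refine intervalIntegral.integral_congr fun u hu => ?_
    have hu0 : 0 < u := hmin.trans_le hu.1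
    rw [Real.mul_rpow hu0.le hx0.le, Real.rpow_sub_one hx0.ne']
    field_simp
  rw [tail_eq_sub hμ hβ hx0, tail_eq_sub hμ hβ hlx0, eq_div_iff (mul_pos hxp hp).ne']
  rw [← hI] at hid
  have hdiv : (l * x) ^ (-β) * VTrunc μ β (l * x) / (x ^ (-β) * VTrunc μ β x) *
      (x ^ (-β) * VTrunc μ β x) = (l * x) ^ (-β) * VTrunc μ β (l * x) :=
    div_mul_cancel₀ _ (mul_pos hxp hp).ne'
  linear_combination -hid - hdiv

/-- Integration by parts at x and at x/2, with T(x) subtracted from every value of the tail. Only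
tail increments remain, and these are what membership in the class Π controls. -/
lemma VTrunc_sub_half (hμ : μ (Iio 0) = 0) (hβ : 0 < β) {x : ℝ} (hx : 0 < x) :
    VTrunc μ β x - VTrunc μ β (x / 2) =
      x ^ β * (β * (∫ u in (1 / 2 : ℝ)..1, u ^ (β - 1) * (tail μ (u * x) - tail μ x)) +
        (1 / 2) ^ β * (tail μ (1 / 2 * x) - tail μ x)) := by
  have hx2 : 1 / 2 * x = x / 2 := by ring
  have h1 := hTrunc_eq μ hμ hβ hx.le
  have h2 := hTrunc_eq μ hμ hβ (half_pos hx).le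
  have h3 := hTrunc_sub μ hβ (x / 2) x
  have hr := integral_rpow_sub_one hβ (1 / 2) 1
  have hsub := intervalIntegral.smul_integral_comp_mul_right (a := 1 / 2) (b := 1)
    (fun y => y ^ (β - 1) * tail μ y) x
  rw [one_mul, hx2, smul_eq_mul] at hsub
  have hu : x * ∫ u in (1 / 2 : ℝ)..1, (u * x) ^ (β - 1) * tail μ (u * x) =
      x ^ β * ∫ u in (1 / 2 : ℝ)..1, u ^ (β - 1) * tail μ (u * x) := by
    rw [← intervalIntegral.integral_const_mul, ← intervalIntegral.integral_const_mul]
    refine intervalIntegral.integral_congr fun u hu => ?_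
    have hu0 : 0 < u := by
      rw [uIcc_of_le (by norm_num)] at hu
      exact lt_of_lt_of_le (by norm_num) hu.1
    rw [Real.mul_rpow hu0.le hx.le, Real.rpow_sub_one hx.ne']
    field_simp
  have hI : IntervalIntegrable (fun u => u ^ (β - 1) * tail μ (u * x)) volume (1 / 2) 1 := by
    refine IntervalIntegrable.continuousOn_mul (f := fun u => tail μ (u * x)) ?_ fun y hy => ?_
    · exact Antitone.intervalIntegrable fun u v huv =>
        tail_antitone μ (mul_le_mul_of_nonneg_right huv hx.le)
    · rw [uIcc_of_le (by norm_num)] at hy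
      exact (Real.continuousAt_rpow_const _ _
        (Or.inl (lt_of_lt_of_le (by norm_num) hy.1).ne')).continuousWithinAt
  have hsplit : ∫ u in (1 / 2 : ℝ)..1, u ^ (β - 1) * (tail μ (u * x) - tail μ x) =
      (∫ u in (1 / 2 : ℝ)..1, u ^ (β - 1) * tail μ (u * x)) -
        (∫ u in (1 / 2 : ℝ)..1, u ^ (β - 1)) * tail μ x := by
    rw [← intervalIntegral.integral_mul_const, ← intervalIntegral.integral_sub hI
      ((intervalIntegral.intervalIntegrable_rpow' (by linarith)).mul_const _)]
    simp only [mul_sub]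
  have hpow : (x / 2) ^ β = (1 / 2) ^ β * x ^ β := by
    rw [← hx2, Real.mul_rpow (by norm_num) hx.le]
  rw [Real.one_rpow] at hr
  rw [hsplit, hx2]
  rw [← hsub, hu] at h3
  rw [hpow] at h2
  linear_combination h3 - h1 + h2 + x ^ β * tail μ x * hr

lemma regularlyVarying_VTrunc_of_deHaanClass (hμ : μ (Iio 0) = 0) (hβ : 0 < β)
    (hV : Tendsto (VTrunc μ β) atTop atTop) (h : DeHaanClass (tail μ)) :
    RegularlyVarying (VTrunc μ β) β := by
  obtain ⟨ℓ, hℓ, c, hc0, hc⟩ := h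
  obtain ⟨⟨X, -, hX⟩, -⟩ := id hℓ
  have hmono := VTrunc_mono μ hβ
  have hhalf : (0 : ℝ) < 1 / 2 := by norm_num
  have hloghalf : Real.log (1 / 2) < 0 := Real.log_neg hhalf (by norm_num)
  -- The tail is nonincreasing and ℓ is eventually positive, which forces the sign of c; this sign
  -- makes C below positive.
  have hcneg : c < 0 := by
    refine lt_of_le_of_ne (not_lt.1 fun hcpos => ?_) hc0
    have : 0 ≤ c * Real.log (1 / 2) := by
      refine ge_of_tendsto (hc _ hhalf) ?_
      filter_upwards [eventually_ge_atTop X, eventually_ge_atTop 0] with x hx hx0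
      exact div_nonneg (sub_nonneg.2 (tail_antitone μ (by linarith))) (hX x hx).le
    exact absurd this (not_le.2 (mul_neg_of_pos_of_neg hcpos hloghalf))
  have hint : Tendsto (fun x => ∫ u in (1 / 2 : ℝ)..1, u ^ (β - 1) *
      ((tail μ (u * x) - tail μ x) / ℓ x)) atTop
      (𝓝 (∫ u in (1 / 2 : ℝ)..1, u ^ (β - 1) * (c * Real.log u))) := by
    refine intervalIntegral.tendsto_integral_filter_of_dominated_convergence
      -- For u between 1/2 and 1 the tail increment is largest at u = 1/2, where its quotient by ℓ
      -- tends to c log(1/2).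
      (fun u => u ^ (β - 1) * (c * Real.log (1 / 2) + 1)) ?_ ?_ ?_ ?_
    · exact Eventually.of_forall fun x =>
        ((by fun_prop : Measurable fun u : ℝ => u ^ (β - 1)).mul
          ((((measurable_tail μ).comp (measurable_id.mul_const x)).sub_const _).div_const
            _)).aestronglyMeasurable
    · filter_upwards [(hc _ hhalf).eventually (gt_mem_nhds (lt_add_one _)),
        eventually_ge_atTop X, eventually_ge_atTop 0] with x h1 h2 h3
      refine Eventually.of_forall fun u hu => ?_
      rw [uIoc_of_le (by norm_num)] at hu
      have hu0 : 0 < u := hhalf.trans hu.1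
      have hp := hX x h2
      have hux : u * x ≤ x := mul_le_of_le_one_left h3 hu.2
      rw [Real.norm_of_nonneg (mul_nonneg (Real.rpow_nonneg hu0.le _)
        (div_nonneg (sub_nonneg.2 (tail_antitone μ hux)) hp.le))]
      refine mul_le_mul_of_nonneg_left (le_trans ?_ h1.le) (Real.rpow_nonneg hu0.le _)
      refine (div_le_div_iff_of_pos_right hp).2 (sub_le_sub_right (tail_antitone μ ?_) _)
      exact mul_le_mul_of_nonneg_right hu.1.le h3
    · exact (intervalIntegral.intervalIntegrable_rpow' (by linarith)).mul_const _
    · refine Eventually.of_forall fun u hu => ?_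
      rw [uIoc_of_le (by norm_num)] at hu
      exact (hc u (hhalf.trans hu.1)).const_mul _
  set C := β * (∫ u in (1 / 2 : ℝ)..1, u ^ (β - 1) * (c * Real.log u)) +
    (1 / 2) ^ β * (c * Real.log (1 / 2)) with hC
  have hCpos : 0 < C := by
    refine add_pos_of_nonneg_of_pos (mul_nonneg hβ.le ?_)
      (mul_pos (Real.rpow_pos_of_pos hhalf _) (mul_pos_of_neg_of_neg hcneg hloghalf))
    refine intervalIntegral.integral_nonneg (by norm_num) fun u hu => ?_
    exact mul_nonneg (Real.rpow_nonneg (hhalf.le.trans hu.1) _)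
      (mul_nonneg_of_nonpos_of_nonpos hcneg.le
        (Real.log_nonpos (hhalf.le.trans hu.1) hu.2))
  have hD : Tendsto (fun x => (VTrunc μ β x - VTrunc μ β (x / 2)) / (x ^ β * ℓ x)) atTop
      (𝓝 C) := by
    refine ((hint.const_mul β).add ((hc _ hhalf).const_mul ((1 / 2) ^ β))).congr' ?_
    filter_upwards [eventually_ge_atTop X, eventually_gt_atTop 0] with x hx hx0
    have hp := hX x hx
    have hxp : 0 < x ^ β := Real.rpow_pos_of_pos hx0 _
    simp only [← mul_div_assoc, intervalIntegral.integral_div]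
    rw [VTrunc_sub_half hμ hβ hx0, mul_div_mul_left _ _ hxp.ne', add_div]
  have hDRV : RegularlyVarying (fun x => VTrunc μ β x - VTrunc μ β (x / 2)) (0 + β) :=
    hℓ.of_tendsto_div (X₀ := 0) ((hmono.measurable.sub (hmono.measurable.comp
      (measurable_id.div_const 2))).comp measurable_subtype_coe) hCpos hD
  rw [zero_add] at hDRV
  obtain ⟨⟨Y, -, hY⟩, hDlim⟩ := hDRV
  obtain ⟨Z, hZ⟩ := eventually_atTop.1 (hV.eventually_gt_atTop 0)
  exact ⟨⟨Z, hmono.measurable.comp measurable_subtype_coe, hZ⟩, fun l hl =>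
    tendsto_div_of_tendsto_dyadic_increment hmono (VTrunc_nonneg μ β) hV hl
      (Real.rpow_pos_of_pos hl _) ((eventually_ge_atTop Y).mono hY) (hDlim l hl)⟩

/-! ### Condition 5 and the passage from h_β to V_β -/

lemma tendsto_VTrunc_div_iff (hμ : μ (Iio 0) = 0) (hβ : 0 < β)
    (hh : Tendsto (hTrunc μ β) atTop atTop) {c : ℝ} :
    Tendsto (fun x => VTrunc μ β x / hTrunc μ β x) atTop (𝓝 (1 - c)) ↔
      Tendsto (fun x => tail μ x * x ^ β / hTrunc μ β x) atTop (𝓝 c) := by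
  have heq : ∀ᶠ x in atTop,
      VTrunc μ β x / hTrunc μ β x = 1 - tail μ x * x ^ β / hTrunc μ β x := by
    filter_upwards [hh.eventually_gt_atTop 0, eventually_ge_atTop 0] with x hx hx0
    rw [eq_sub_iff_add_eq, ← add_div, mul_comm, ← hTrunc_eq μ hμ hβ hx0, div_self hx.ne']
  rw [tendsto_congr' heq]
  refine ⟨fun h => ?_, fun h => h.const_sub 1⟩
  simpa using h.const_sub 1

/-- The limit 1 - ρ/β of V/h is positive precisely because ρ < β, so V inherits the index of h. -/
lemma regularlyVarying_VTrunc_of_hTrunc (hμ : μ (Iio 0) = 0) (hβ : 0 < β) (hρ : ρ < β)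
    (hh : Tendsto (hTrunc μ β) atTop atTop) (h : RegularlyVarying (hTrunc μ β) ρ) :
    RegularlyVarying (VTrunc μ β) ρ := by
  rw [← add_zero ρ]
  refine h.of_tendsto_div (X₀ := 0) ((VTrunc_mono μ hβ).measurable.comp measurable_subtype_coe)
    (sub_pos.2 ((div_lt_one hβ).2 hρ)) ?_
  simp only [Real.rpow_zero, one_mul]
  exact (tendsto_VTrunc_div_iff hμ hβ hh).2 (tendsto_of_regularlyVarying_hTrunc hβ h)

end Truncated

end TruncatedMoments

/-! ### Assembly over the three ranges of ρ -/

theorem mainTheorem1 (μ : Measure ℝ) [IsProbabilityMeasure μ] (hμ : μ (Iio 0) = 0)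
    (β : ℝ) (hβ : 0 < β) (hinf : ∫⁻ y in Ici (0 : ℝ), ENNReal.ofReal (y ^ β) ∂μ = ⊤) :
    -- the case `0 < ρ < β`
    (∀ ρ : ℝ, 0 < ρ → ρ < β →
      List.TFAE [
        TruncatedMoments.RegularlyVarying (TruncatedMoments.hTrunc μ β) ρ,
        TruncatedMoments.RegularlyVarying (TruncatedMoments.VTrunc μ β) ρ,
        TruncatedMoments.RegularlyVarying (TruncatedMoments.tail μ) (ρ - β),
        Tendsto (fun x => TruncatedMoments.tail μ x * x ^ β / TruncatedMoments.hTrunc μ β x)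
          atTop (𝓝 (ρ / β)),
        Tendsto (fun x => TruncatedMoments.VTrunc μ β x / TruncatedMoments.hTrunc μ β x)
          atTop (𝓝 (1 - ρ / β))]) ∧
    -- the case `ρ = 0`
    (List.TFAE [
        TruncatedMoments.RegularlyVarying (TruncatedMoments.hTrunc μ β) 0,
        TruncatedMoments.RegularlyVarying (TruncatedMoments.VTrunc μ β) 0,
        Tendsto (fun x => TruncatedMoments.tail μ x * x ^ β / TruncatedMoments.hTrunc μ β x)
          atTop (𝓝 0),
        Tendsto (fun x => TruncatedMoments.VTrunc μ β x / TruncatedMoments.hTrunc μ β x)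
          atTop (𝓝 1)] ∧
      (TruncatedMoments.RegularlyVarying (TruncatedMoments.tail μ) (-β) →
        TruncatedMoments.RegularlyVarying (TruncatedMoments.hTrunc μ β) 0 ∧
        TruncatedMoments.RegularlyVarying (TruncatedMoments.VTrunc μ β) 0 ∧
        Tendsto (fun x => TruncatedMoments.tail μ x * x ^ β / TruncatedMoments.hTrunc μ β x)
          atTop (𝓝 0) ∧
        Tendsto (fun x => TruncatedMoments.VTrunc μ β x / TruncatedMoments.hTrunc μ β x)
          atTop (𝓝 1))) ∧
    -- the case `ρ = β`
    (List.TFAE [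
        TruncatedMoments.RegularlyVarying (TruncatedMoments.hTrunc μ β) β,
        TruncatedMoments.RegularlyVarying (TruncatedMoments.tail μ) 0,
        Tendsto (fun x => TruncatedMoments.tail μ x * x ^ β / TruncatedMoments.hTrunc μ β x)
          atTop (𝓝 1),
        Tendsto (fun x => TruncatedMoments.VTrunc μ β x / TruncatedMoments.hTrunc μ β x)
          atTop (𝓝 0)] ∧
      (TruncatedMoments.RegularlyVarying (TruncatedMoments.VTrunc μ β) β →
        TruncatedMoments.RegularlyVarying (TruncatedMoments.hTrunc μ β) β ∧
        TruncatedMoments.RegularlyVarying (TruncatedMoments.tail μ) 0 ∧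
        Tendsto (fun x => TruncatedMoments.tail μ x * x ^ β / TruncatedMoments.hTrunc μ β x)
          atTop (𝓝 1) ∧
        Tendsto (fun x => TruncatedMoments.VTrunc μ β x / TruncatedMoments.hTrunc μ β x)
          atTop (𝓝 0)) ∧
      (TruncatedMoments.RegularlyVarying (TruncatedMoments.VTrunc μ β) β ↔
        TruncatedMoments.DeHaanClass (TruncatedMoments.tail μ))) := by
  have hV := TruncatedMoments.tendsto_VTrunc_atTop μ hβ hinf
  have hh := TruncatedMoments.tendsto_hTrunc_atTop hμ hβ hV
  have h14 := fun ρ => TruncatedMoments.regularlyVarying_hTrunc_iff (μ := μ) (ρ := ρ) hβ hh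
  have h54 := fun c => TruncatedMoments.tendsto_VTrunc_div_iff (c := c) hμ hβ hh
  have h21 := fun ρ => TruncatedMoments.regularlyVarying_hTrunc_of_VTrunc (ρ := ρ) hμ hβ hh
  have h31 := fun ρ => TruncatedMoments.regularlyVarying_hTrunc_of_tail (ρ := ρ) hβ hh
  have hzero : List.TFAE [
        TruncatedMoments.RegularlyVarying (TruncatedMoments.hTrunc μ β) 0,
        TruncatedMoments.RegularlyVarying (TruncatedMoments.VTrunc μ β) 0,
        Tendsto (fun x => TruncatedMoments.tail μ x * x ^ β / TruncatedMoments.hTrunc μ β x)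
          atTop (𝓝 0),
        Tendsto (fun x => TruncatedMoments.VTrunc μ β x / TruncatedMoments.hTrunc μ β x)
          atTop (𝓝 1)] := by
    tfae_have 1 → 2 := TruncatedMoments.regularlyVarying_VTrunc_of_hTrunc hμ hβ hβ hh
    tfae_have 2 → 1 := h21 0
    tfae_have 1 ↔ 3 := by simpa using h14 0
    tfae_have 4 ↔ 3 := by simpa using h54 0
    tfae_finish
  have hone : List.TFAE [
        TruncatedMoments.RegularlyVarying (TruncatedMoments.hTrunc μ β) β,
        TruncatedMoments.RegularlyVarying (TruncatedMoments.tail μ) 0,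
        Tendsto (fun x => TruncatedMoments.tail μ x * x ^ β / TruncatedMoments.hTrunc μ β x)
          atTop (𝓝 1),
        Tendsto (fun x => TruncatedMoments.VTrunc μ β x / TruncatedMoments.hTrunc μ β x)
          atTop (𝓝 0)] := by
    tfae_have 1 → 2 := by
      simpa using TruncatedMoments.regularlyVarying_tail_of_hTrunc (μ := μ) hβ hβ
    tfae_have 2 → 1 := by simpa using h31 β
    tfae_have 1 ↔ 3 := by simpa [div_self hβ.ne'] using h14 β
    tfae_have 4 ↔ 3 := by simpa using h54 1
    tfae_finish
  refine ⟨fun ρ hρ hρβ => ?_, ⟨hzero, fun h => ?_⟩, hone, fun h => ?_,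
    TruncatedMoments.deHaanClass_tail_of_VTrunc hμ hβ,
    TruncatedMoments.regularlyVarying_VTrunc_of_deHaanClass hμ hβ hV⟩
  · tfae_have 1 → 2 := TruncatedMoments.regularlyVarying_VTrunc_of_hTrunc hμ hβ hρβ hh
    tfae_have 2 → 1 := h21 ρ
    tfae_have 1 → 3 := TruncatedMoments.regularlyVarying_tail_of_hTrunc hβ hρ
    tfae_have 3 → 1 := h31 ρ
    tfae_have 1 ↔ 4 := h14 ρ
    tfae_have 5 ↔ 4 := h54 (ρ / β)
    tfae_finish
  · have h1 := h31 0 (by simpa using h)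
    exact ⟨h1, (hzero.out 0 1).1 h1, (hzero.out 0 2).1 h1, (hzero.out 0 3).1 h1⟩
  · have h1 := h21 β h
    exact ⟨h1, (hone.out 0 1).1 h1, (hone.out 0 2).1 h1, (hone.out 0 3).1 h1⟩
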